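/- Let $H=\frac{1}{\sqrt2}\begin{pmatrix}1&1\\1&-1\end{pmatrix}$ and, for $N=2^k$ with $k\ge 1$, let $Z_N=\mathrm{diag}(1,e^{i\pi/N})$, an $N$-th root of the Pauli gate $Z$ (so $Z_2=S$ and $Z_4=T$). A Clifford+$Z_N$ circuit on $n$ qubits is a finite sequence of gates, each of which is a Hadamard gate $H$, a CNOT gate, or a phase gate $Z_N$ or $Z_N^\dagger$ with $N=2^k$ for some $k\ge1$, where $N$ may differ from gate to gate; the circuit is ancilla-free in that it acts on these $n$ qubits only. Its phase depth is the minimum number of cycles in which all its phase gates ($S$ and $T$ included) can be executed: in one cycle, phase gates on distinct qubits are executed in parallel, the Hadamard and CNOT gates are executed between the cycles at no cost, and gates that share a qubit are executed in the order of the circuit. The $n$-MCT gate is the unitary on $n$ qubits with $|c_1,\dots,c_{n-1},c_n\rangle\mapsto|c_1,\dots,c_{n-1},c_n\oplus c_1c_2\cdots c_{n-1}\rangle$. For every $n\ge4$ there is an ancilla-free Clifford+$Z_N$ circuit on $n$ qubits whose unitary is exactly the $n$-MCT gate and whose phase depth is $7$ if $n=4$, $13$ if $n=5$, and $4n-6$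 if $n\ge6$. In particular, the $n$-MCT gate has an ancilla-free exact decomposition over the Clifford+$Z_N$ library with phase depth $O(n)$. -/

import Mathlib

noncomputable section

namespace CliffordZN

/-- Computational basis states of `n` qubits. The addition and multiplication of `Fin 2`
are XOR and AND. -/
abbrev Basis (n : ℕ) : Type := Fin n → Fin 2

/-- Operators on the state space of `n` qubits; the entry at `(x, y)` is `⟨x| U |y⟩`. -/
abbrev Op (n : ℕ) : Type := Matrix (Basis n) (Basis n) ℂ

/-- The one-qubit operator `U` on qubit `q`, tensored with the identity on the other qubits. -/
def onQubit {n : ℕ} (U : Matrix (Fin 2) (Fin 2) ℂ) (q : Fin n) : Op n :=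
  fun x y => if ∀ j, j ≠ q → x j = y j then U (x q) (y q) else 0

/-- The operator `|y⟩ ↦ |f y⟩`. -/
def ofBasisMap {n : ℕ} (f : Basis n → Basis n) : Op n :=
  fun x y => if x = f y then 1 else 0

/-- The Hadamard matrix. -/
def hadamard : Matrix (Fin 2) (Fin 2) ℂ :=
  ((1 / Real.sqrt 2 : ℝ) : ℂ) • !![1, 1; 1, -1]

/-- The `N`-th root `Z_N = diag (1, exp (i π / N))` of the Pauli matrix `Z`. -/
def zRoot (N : ℕ) : Matrix (Fin 2) (Fin 2) ℂ :=
  !![1, 0; 0, Complex.exp (Complex.I * Real.pi / N)]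

/-- The gate library on `n` qubits: Hadamard gates, CNOT gates, and the phase gates `Z_N` and
`Z_N†` for `N = 2 ^ k`, `k ≥ 1`. The gates `S = Z_2` and `T = Z_4` are among the latter. -/
inductive Gate (n : ℕ) : Type
  | H (q : Fin n)
  | CNOT (c t : Fin n) (h : c ≠ t)
  | Z (k : ℕ) (hk : 1 ≤ k) (q : Fin n)
  | Zdag (k : ℕ) (hk : 1 ≤ k) (q : Fin n)

namespace Gate

variable {n : ℕ}

/-- The unitary operator of a gate. -/
def toOp : Gate n → Op n
  | H q => onQubit hadamard q
  | CNOT c t _ => ofBasisMap fun y => Function.update y t (y t + y c)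
  | Z k _ q => onQubit (zRoot (2 ^ k)) q
  | Zdag k _ q => onQubit (zRoot (2 ^ k)).conjTranspose q

/-- The qubits on which a gate acts. -/
def support : Gate n → Finset (Fin n)
  | H q => {q}
  | CNOT c t _ => {c, t}
  | Z _ _ q => {q}
  | Zdag _ _ q => {q}

/-- The number of phase cycles that a gate takes: one for every phase gate `Z_N` or `Z_N†`
(including `S` and `T`), none for the Hadamard and CNOT gates. -/
def phaseCost : Gate n → ℕ
  | H _ => 0
  | CNOT _ _ _ => 0
  | Z _ _ _ => 1
  | Zdag _ _ _ => 1

end Gate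

/-- A circuit on exactly `n` qubits (so without ancillas): the list of its gates, in the order
in which they are applied. -/
abbrev Circuit (n : ℕ) : Type := List (Gate n)

namespace Circuit

variable {n : ℕ}

/-- The operator of a circuit; the head of the list acts first. -/
def toOp : Circuit n → Op n
  | [] => 1
  | g :: C => toOp C * g.toOp

/-- `τ` executes the circuit `C` in the phase cycles `1, …, d`. A phase gate `i` is executed in
cycle `τ i`; a gate `i` that is not a phase gate is executed after cycle `τ i` and before cycle
`τ i + 1`. Gates that act on a common qubit are executed in their order in `C`; in particular
no cycle holds two phase gates on the same qubit. -/
structure IsSchedule (C : Circuit n) (d : ℕ) (τ : Fin C.length → ℕ) : Prop where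
  start : ∀ i, (C.get i).phaseCost ≤ τ i
  finish : ∀ i, τ i ≤ d
  order : ∀ i j, i < j → ¬ Disjoint (C.get i).support (C.get j).support →
    τ i + (C.get j).phaseCost ≤ τ j

/-- The phase depth of a circuit: the minimum number of cycles in which all its phase gates can
be executed. -/
def phaseDepth (C : Circuit n) : ℕ :=
  sInf {d | ∃ τ : Fin C.length → ℕ, IsSchedule C d τ}

/-- Every circuit has a schedule, so that the infimum above is a minimum. -/
theorem exists_isSchedule (C : Circuit n) :
    ∃ (d : ℕ) (τ : Fin C.length → ℕ), IsSchedule C d τ := by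
  have hc : ∀ g : Gate n, g.phaseCost ≤ 1 := by
    intro g; cases g <;> simp [Gate.phaseCost]
  refine ⟨C.length, fun i => i.1 + 1, ⟨fun i => ?_, fun i => i.2, fun i j hij _ => ?_⟩⟩
  · exact (hc _).trans (Nat.le_add_left 1 _)
  · have h1 := hc (C.get j)
    have h2 : i.1 < j.1 := hij
    show i.1 + 1 + (C.get j).phaseCost ≤ j.1 + 1
    omega

end Circuit

/-- The multi-controlled Toffoli gate on `n` qubits with target `t`, whose controls are all the
other qubits: it replaces the bit of `t` by its XOR with the product of the control bits. -/
def mct {n : ℕ} (t : Fin n) : Op n :=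
  ofBasisMap fun y => Function.update y t (y t + ∏ j ∈ Finset.univ.erase t, y j)

end CliffordZN

end

/-! Let n = m + 1. Add control bit 0 to the integer in bits 1, …, m, then subtract it from the
integer in bits 1, …, m - 1. All carries are undone except the one into the last bit, which is the
product of the controls. So the gate is a decrement after an increment (`mct_eq_conj_mul_conj`).

In the Fourier basis an increment is diagonal; one Hadamard gate and some controlled phases per bit
lead there (`inc_eq_fourier`). Since 2uv = u + v - (u ⊕ v), controlled phases become phases on bits
and on parities. CNOT gates expose all parities of bit j with the lower bits at once, so each stage
takes one cycle. The one-qubit remainders commute away or cancel between increment and decrement,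
once a correction fills the free slot in each stage of the longer transform (`inc_eq_conj`,
`prePhase_eq`). The first stage has no phases and each diagonal middle takes two cycles, giving (2 +
2(m - 1)) + (2 + 2(m - 2)) = 4n - 6.

For n = 4, 5 this count is 10 and 14, which is too large. There the multi-controlled Z is expanded
into all parities, which fit into 4 and 7 explicit cycles.

These are upper bounds, while exact depths are required. Replacing a phase gate by two copies of its
square root keeps the unitary and raises the depth by at most one; repetition makes the depth
unbounded, so every larger value is attained (`Executable.exists_phaseDepth_eq`). -/

noncomputable section

namespace CliffordZN

variable {n : ℕ}

/-! ### Timed schedules and phase depth -/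

namespace Circuit

/-- A list of timed gates that respects the order of gates sharing a qubit. -/
def IsTimed (d : ℕ) (T : List (Gate n × ℕ)) : Prop :=
  (∀ a ∈ T, a.1.phaseCost ≤ a.2 ∧ a.2 ≤ d) ∧
    T.Pairwise fun a b => ¬ Disjoint a.1.support b.1.support → a.2 + b.1.phaseCost ≤ b.2

/-- The circuit can be executed in `d` phase cycles. -/
def Executable (C : Circuit n) (d : ℕ) : Prop :=
  ∃ T : List (Gate n × ℕ), T.map Prod.fst = C ∧ IsTimed d T

/-- Lists of timed gates can be concatenated, split and mapped without reindexing `Fin C.length`. -/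
theorem executable_iff (C : Circuit n) (d : ℕ) :
    C.Executable d ↔ ∃ τ : Fin C.length → ℕ, IsSchedule C d τ := by
  constructor
  · rintro ⟨T, rfl, hb, ho⟩
    have hl : (T.map Prod.fst).length = T.length := by simp
    refine ⟨fun i => (T.get (i.cast hl)).2, ⟨fun i => ?_, fun i => ?_, fun i j hij => ?_⟩⟩
    · simpa using (hb _ (T.get_mem (i.cast hl))).1
    · exact (hb _ (T.get_mem (i.cast hl))).2
    · simpa using List.pairwise_iff_get.1 ho (i.cast hl) (j.cast hl) hij
  · rintro ⟨τ, h⟩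
    refine ⟨List.ofFn fun i => (C.get i, τ i), ?_, ?_, ?_⟩
    · rw [List.map_ofFn]; exact List.ofFn_get C
    · intro a ha
      obtain ⟨i, rfl⟩ := List.mem_ofFn.1 ha
      exact ⟨h.start i, h.finish i⟩
    · rw [List.pairwise_ofFn]
      exact fun i j hij => h.order i j hij

theorem phaseDepth_eq_sInf (C : Circuit n) : C.phaseDepth = sInf {d | C.Executable d} := by
  simp only [phaseDepth, executable_iff]

theorem executable_phaseDepth (C : Circuit n) : C.Executable C.phaseDepth := by
  rw [phaseDepth_eq_sInf]
  obtain ⟨d, hd⟩ := exists_isSchedule C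
  exact Nat.sInf_mem (s := {d | C.Executable d}) ⟨d, (executable_iff C d).2 hd⟩

theorem phaseDepth_le {C : Circuit n} {d : ℕ} (h : C.Executable d) : C.phaseDepth ≤ d := by
  rw [phaseDepth_eq_sInf]; exact Nat.sInf_le h

theorem Executable.append {C D : Circuit n} {d e : ℕ} (hC : C.Executable d)
    (hD : D.Executable e) : Executable (C ++ D) (d + e) := by
  obtain ⟨T, rfl, hb, ho⟩ := hC
  obtain ⟨T', rfl, hb', ho'⟩ := hD
  refine ⟨T ++ T'.map fun a => (a.1, d + a.2), ?_, ?_, ?_⟩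
  · simp [Function.comp_def]
  · intro a ha
    rcases List.mem_append.1 ha with ha | ha
    · have := hb a ha; omega
    · obtain ⟨b, hb1, rfl⟩ := List.mem_map.1 ha
      have := hb' b hb1; dsimp only; omega
  · refine List.pairwise_append.2 ⟨ho, ?_, ?_⟩
    · rw [List.pairwise_map]
      exact ho'.imp fun h hd => by have := h hd; dsimp only; omega
    · intro a ha b hbm _
      obtain ⟨b, hb1, rfl⟩ := List.mem_map.1 hbm
      have := hb a ha; have := hb' b hb1; dsimp only; omega

theorem Executable.mono {C : Circuit n} {d e : ℕ} (hC : C.Executable d) (h : d ≤ e) :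
    C.Executable e := by
  obtain ⟨T, rfl, hb, ho⟩ := hC
  exact ⟨T, rfl, fun a ha => ⟨(hb a ha).1, (hb a ha).2.trans h⟩, ho⟩

theorem executable_nil : Executable ([] : Circuit n) 0 := ⟨[], rfl, by simp, List.Pairwise.nil⟩

theorem executable_zero {C : Circuit n} (h : ∀ g ∈ C, g.phaseCost = 0) : C.Executable 0 := by
  refine ⟨C.map fun g => (g, 0), by simp [Function.comp_def], ?_, ?_⟩
  · intro a ha
    obtain ⟨g, hg, rfl⟩ := List.mem_map.1 ha
    simp [h g hg]
  · rw [List.pairwise_map]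
    exact List.pairwise_of_forall_mem_list fun a _ b hb _ => by simp [h b hb]

theorem _root_.CliffordZN.Gate.phaseCost_le_one (g : Gate n) : g.phaseCost ≤ 1 := by
  cases g <;> simp [Gate.phaseCost]

theorem executable_one {C : Circuit n}
    (h : C.Pairwise fun g g' => Disjoint g.support g'.support) : C.Executable 1 := by
  refine ⟨C.map fun g => (g, 1), by simp [Function.comp_def], ?_, ?_⟩
  · intro a ha
    obtain ⟨g, hg, rfl⟩ := List.mem_map.1 ha
    exact ⟨g.phaseCost_le_one, le_rfl⟩
  · rw [List.pairwise_map]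
    exact h.imp fun h h' => absurd h h'

theorem toOp_append (C D : Circuit n) : toOp (C ++ D) = toOp D * toOp C := by
  induction C with
  | nil => simp [toOp]
  | cons g C ih => simp only [List.cons_append, toOp, ih, Matrix.mul_assoc]

/-- Replacing a phase gate by two phase gates takes at most one more cycle. -/
theorem Executable.split_phase {A B : Circuit n} {g g₁ g₂ : Gate n} {d : ℕ}
    (h : Executable (A ++ g :: B) d) (hs₁ : g₁.support = g.support) (hs₂ : g₂.support = g.support)
    (hg : g.phaseCost = 1) (hg₁ : g₁.phaseCost = 1) (hg₂ : g₂.phaseCost = 1) :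
    Executable (A ++ g₁ :: g₂ :: B) (d + 1) := by
  obtain ⟨T, hT, hb, ho⟩ := h
  obtain ⟨TA, T', rfl, rfl, hT'⟩ := List.map_eq_append_iff.1 hT
  obtain ⟨⟨a, t⟩, TB, rfl, rfl, rfl⟩ := List.map_eq_cons_iff.1 hT'
  dsimp only at hs₁ hs₂ hg
  obtain ⟨hA, hB, hAB⟩ := List.pairwise_append.1 ho
  obtain ⟨haB, hB⟩ := List.pairwise_cons.1 hB
  have hat := hb (a, t) (by simp)
  dsimp only at hat
  -- All gates after the split are delayed by one cycle, those on other qubits too.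
  refine ⟨TA ++ (g₁, t) :: (g₂, t + 1) :: TB.map fun b => (b.1, b.2 + 1), ?_, ?_, ?_⟩
  · simp [Function.comp_def]
  · intro x hx
    simp only [List.mem_append, List.mem_cons, List.mem_map] at hx
    rcases hx with hx | rfl | rfl | ⟨b, hbm, rfl⟩
    · have := hb x (by simp [hx]); omega
    · dsimp only; omega
    · dsimp only; omega
    · have := hb b (by simp [hbm]); dsimp only; omega
  · refine List.pairwise_append.2 ⟨hA, ?_, ?_⟩
    · refine List.pairwise_cons.2 ⟨?_, List.pairwise_cons.2 ⟨?_, ?_⟩⟩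
      · intro x hx hd
        simp only [List.mem_cons, List.mem_map] at hx
        rcases hx with rfl | ⟨b, hbm, rfl⟩
        · dsimp only; omega
        · have := haB b hbm (by simpa [hs₁] using hd); dsimp only at this ⊢; omega
      · intro x hx hd
        obtain ⟨b, hbm, rfl⟩ := List.mem_map.1 hx
        have := haB b hbm (by simpa [hs₂] using hd); dsimp only at this ⊢; omega
      · rw [List.pairwise_map]
        exact hB.imp fun h hd => by have := h hd; dsimp only; omega
    · intro x hx y hy hd
      simp only [List.mem_cons, List.mem_map] at hy
      rcases hy with rfl | rfl | ⟨b, hbm, rfl⟩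
      · have := hAB x hx (a, t) (by simp) (by simpa [hs₁] using hd)
        dsimp only at this ⊢; omega
      · have := hAB x hx (a, t) (by simp) (by simpa [hs₂] using hd)
        dsimp only at this ⊢; omega
      · have := hAB x hx b (by simp [hbm]) hd; dsimp only at this ⊢; omega

/-- Induction along the list, with `s` a cycle already passed: all gates share `q`, so each one
strictly raises `s`. -/
theorem length_le_of_isTimed {d : ℕ} (q : Fin n) (R : List (Gate n × ℕ))
    (hR : ∀ a ∈ R, q ∈ a.1.support ∧ a.1.phaseCost = 1) (h : IsTimed d R) (s : ℕ) (hs : s ≤ d)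
    (hlow : ∀ a ∈ R, s + 1 ≤ a.2) : s + R.length ≤ d := by
  induction R generalizing s with
  | nil => simpa using hs
  | cons a R ih =>
    obtain ⟨hb, ho⟩ := h
    obtain ⟨h1, h2⟩ := List.pairwise_cons.1 ho
    have ha := hb a (by simp)
    have hqa := hR a (by simp)
    have h3 := hlow a (by simp)
    have := ih (fun b hb => hR b (by simp [hb])) ⟨fun b hbm => hb b (by simp [hbm]), h2⟩ a.2
      ha.2 (fun b hbm => by
        have hqb := hR b (by simp [hbm])
        have := h1 b hbm (Finset.not_disjoint_iff.2 ⟨q, hqa.1, hqb.1⟩)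
        omega)
    simp only [List.length_cons]
    omega

/-- Phase gates on one qubit have to be executed one after the other. -/
theorem length_le_of_executable {A R B : Circuit n} {d : ℕ} (h : Executable (A ++ (R ++ B)) d)
    (q : Fin n) (hR : ∀ g ∈ R, q ∈ g.support ∧ g.phaseCost = 1) : R.length ≤ d := by
  obtain ⟨T, hT, hb, ho⟩ := h
  obtain ⟨TA, T', rfl, rfl, hT'⟩ := List.map_eq_append_iff.1 hT
  obtain ⟨TR, TB, rfl, rfl, rfl⟩ := List.map_eq_append_iff.1 hT'
  have hR' : ∀ a ∈ TR, q ∈ a.1.support ∧ a.1.phaseCost = 1 := fun a ha =>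
    hR a.1 (List.mem_map_of_mem ha)
  have := length_le_of_isTimed q TR hR'
    ⟨fun a ha => hb a (by simp [ha]), (List.pairwise_append.1 (List.pairwise_append.1 ho).2.1).1⟩
    0 (Nat.zero_le _) (fun a ha => by
      have h1 := hb a (by simp [ha]); have h2 := hR' a ha; omega)
  simpa using this

end Circuit

/-! ### Diagonal phase operators -/

/-- The diagonal operator `|y⟩ ↦ exp (i π g(y)) |y⟩`. -/
def phase (g : Basis n → ℝ) : Op n :=
  Matrix.diagonal fun y => Complex.exp (Complex.I * Real.pi * (g y : ℂ))

theorem phase_mul (g h : Basis n → ℝ) : phase g * phase h = phase (g + h) := by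
  simp only [phase, Matrix.diagonal_mul_diagonal, ← Complex.exp_add, Pi.add_apply,
    Complex.ofReal_add, mul_add]

theorem phase_zero : phase (0 : Basis n → ℝ) = 1 := by
  simp [phase]

theorem onQubit_diagonal (q : Fin n) (a : ℝ) (U : Matrix (Fin 2) (Fin 2) ℂ)
    (hU : U = !![1, 0; 0, Complex.exp (Complex.I * Real.pi * (a : ℂ))]) :
    onQubit U q = phase fun y => a * ((y q).val : ℝ) := by
  subst hU
  ext x y
  simp only [onQubit, phase, Matrix.diagonal_apply]
  by_cases hxy : x = y
  · subst hxy
    simp only [implies_true, if_true]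
    generalize x q = u
    fin_cases u <;> simp
  · rw [if_neg hxy]
    split_ifs with h
    · have hq : x q ≠ y q := fun hq => hxy (funext fun j => by
        by_cases hj : j = q
        · exact hj ▸ hq
        · exact h j hj)
      revert hq
      generalize x q = u
      generalize y q = v
      fin_cases u <;> fin_cases v <;> simp
    · rfl

theorem Gate.toOp_Z (k : ℕ) (hk : 1 ≤ k) (q : Fin n) :
    (Gate.Z k hk q).toOp = phase fun y => (2 ^ k : ℝ)⁻¹ * ((y q).val : ℝ) := by
  refine onQubit_diagonal q _ _ ?_
  simp [zRoot, div_eq_mul_inv]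

theorem Gate.toOp_Zdag (k : ℕ) (hk : 1 ≤ k) (q : Fin n) :
    (Gate.Zdag k hk q).toOp = phase fun y => -(2 ^ k : ℝ)⁻¹ * ((y q).val : ℝ) := by
  refine onQubit_diagonal q _ _ ?_
  ext i j
  fin_cases i <;> fin_cases j <;>
    simp [zRoot, div_eq_mul_inv, ← Complex.exp_conj, Complex.conj_ofNat]

/-! ### Padding to a prescribed depth -/

namespace Circuit

/-- Discrete intermediate values: the first index at which `f` reaches `D` cannot overshoot. -/
theorem _root_.Nat.exists_eq_of_succ_le_add_one (f : ℕ → ℕ) (D : ℕ) (h0 : f 0 ≤ D)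
    (hstep : ∀ m, f (m + 1) ≤ f m + 1) (hlow : ∀ m, m ≤ f m) : ∃ m, f m = D := by
  classical
  have hex : ∃ m, D ≤ f m := ⟨D, hlow D⟩
  have hspec := Nat.find_spec hex
  refine ⟨Nat.find hex, le_antisymm ?_ hspec⟩
  rcases hm : Nat.find hex with _ | m
  · exact h0
  · have h1 : ¬ D ≤ f m := Nat.find_min hex (by omega)
    have := hstep m
    omega

/-- The gates `G m, …, G 2, G 1`. -/
def descending (G : ℕ → Gate n) : ℕ → Circuit n
  | 0 => []
  | m + 1 => G (m + 1) :: descending G m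

theorem length_descending (G : ℕ → Gate n) (m : ℕ) : (descending G m).length = m := by
  induction m with
  | zero => rfl
  | succ m ih => simp [descending, ih]

theorem mem_descending (G : ℕ → Gate n) (m : ℕ) {g : Gate n} (hg : g ∈ descending G m) :
    ∃ k, g = G k := by
  induction m with
  | zero => simp [descending] at hg
  | succ m ih =>
    rcases List.mem_cons.1 hg with rfl | hg
    · exact ⟨_, rfl⟩
    · exact ih hg

/-- If `G (k + 1)` is a square root of `G k`, then splitting the phase gate `G 0` repeatedly
yields every phase depth above the given one. -/
theorem exists_phaseDepth_eq_of_sqrt {A B : Circuit n} {d D : ℕ} (q : Fin n) (G : ℕ → Gate n)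
    (hG : ∀ k, (G k).support = {q} ∧ (G k).phaseCost = 1)
    (hsq : ∀ k, (G (k + 1)).toOp * (G (k + 1)).toOp = (G k).toOp)
    (h : Executable (A ++ G 0 :: B) d) (hd : d ≤ D) :
    ∃ C : Circuit n, C.toOp = toOp (A ++ G 0 :: B) ∧ C.phaseDepth = D := by
  -- The gates `G m, G m, G (m - 1), …, G 1` telescope to `G 0`, the first two merging each time.
  -- For `m ≥ 1` they are `m + 1` successive phase gates on `q`, which bounds the depth from below.
  let C : ℕ → Circuit n := fun m => A ++ G m :: (descending G m ++ B)
  have hop : ∀ m, toOp (C m) = toOp (A ++ G 0 :: B) := by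
    intro m
    induction m with
    | zero => rfl
    | succ m ih =>
      rw [← ih]
      simp only [C, toOp_append, toOp, descending, List.cons_append, ← hsq m, Matrix.mul_assoc]
  obtain ⟨m, hm⟩ := Nat.exists_eq_of_succ_le_add_one (fun m => (C m).phaseDepth) D
    ((phaseDepth_le h).trans hd)
    (fun m => phaseDepth_le ((executable_phaseDepth (C m)).split_phase
      (by rw [(hG _).1, (hG _).1]) (by rw [(hG _).1, (hG _).1]) (hG _).2 (hG _).2 (hG _).2))
    (fun m => by
      have := length_le_of_executable (A := A) (R := G m :: descending G m) (B := B)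
        (executable_phaseDepth (C m)) q (fun g hg => by
          rcases List.mem_cons.1 hg with rfl | hg
          · simp [hG]
          · obtain ⟨k, rfl⟩ := mem_descending G m hg
            simp [hG])
      simp only [List.length_cons, length_descending] at this
      show m ≤ (C m).phaseDepth
      omega)
  exact ⟨C m, hop m, hm⟩

/-- A circuit that can be executed in `d` cycles can be modified to have any given phase depth
`D ≥ d`. -/
theorem Executable.exists_phaseDepth_eq {C : Circuit n} {d D : ℕ} (h : C.Executable d)
    (hd : d ≤ D) (hD : 2 ≤ D) (q : Fin n) :
    ∃ C' : Circuit n, C'.toOp = C.toOp ∧ C'.phaseDepth = D := by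
  have hZ : ∀ (A B : Circuit n) (k : ℕ) (hk : 1 ≤ k) (q : Fin n) (d : ℕ),
      Executable (A ++ Gate.Z k hk q :: B) d → d ≤ D →
      ∃ C' : Circuit n, C'.toOp = toOp (A ++ Gate.Z k hk q :: B) ∧ C'.phaseDepth = D := by
    intro A B k hk q d h hd
    refine exists_phaseDepth_eq_of_sqrt q (fun j => Gate.Z (k + j) (by omega) q)
      (fun j => ⟨rfl, rfl⟩) (fun j => ?_) h hd
    simp only [Gate.toOp_Z, phase_mul, ← add_assoc, pow_succ]
    congr 1
    ext y
    simp only [Pi.add_apply]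
    ring
  by_cases hC : ∃ g ∈ C, g.phaseCost = 1
  · obtain ⟨g, hg, hcost⟩ := hC
    obtain ⟨A, B, rfl⟩ := List.append_of_mem hg
    cases g with
    | H q => simp [Gate.phaseCost] at hcost
    | CNOT c t hct => simp [Gate.phaseCost] at hcost
    | Z k hk q => exact hZ A B k hk q d h hd
    | Zdag k hk q =>
      refine exists_phaseDepth_eq_of_sqrt q (fun j => Gate.Zdag (k + j) (by omega) q)
        (fun j => ⟨rfl, rfl⟩) (fun j => ?_) h hd
      simp only [Gate.toOp_Zdag, phase_mul, ← add_assoc, pow_succ]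
      congr 1
      ext y
      simp only [Pi.add_apply]
      ring
  -- Without phase gates there is nothing to split, so `S` and `S†` are appended; this is where `2 ≤
  -- D` is needed.
  · have h0 : C.Executable 0 := executable_zero fun g hg => by
      have h1 := g.phaseCost_le_one
      have h2 : g.phaseCost ≠ 1 := fun h2 => hC ⟨g, hg, h2⟩
      omega
    have h2 : Executable ([Gate.Z 1 le_rfl q] ++ [Gate.Zdag 1 le_rfl q]) (1 + 1) :=
      (executable_one (by simp)).append (executable_one (by simp))
    obtain ⟨C', h3, h4⟩ := hZ C [Gate.Zdag 1 le_rfl q] 1 le_rfl q _ (h0.append h2) (by omega)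
    refine ⟨C', ?_, h4⟩
    have h5 : (fun y : Basis n => -(2 ^ 1 : ℝ)⁻¹ * ((y q).val : ℝ)) +
        (fun y => (2 ^ 1 : ℝ)⁻¹ * ((y q).val : ℝ)) = 0 := by
      ext y; simp
    rw [h3, toOp_append]
    simp only [toOp, Gate.toOp_Z, Gate.toOp_Zdag, phase_mul, Matrix.one_mul, h5,
      phase_zero]

end Circuit

/-! ### Action on basis vectors and commutation rules -/

/-- The basis vector `|y⟩`. -/
def ket (y : Basis n) : Basis n → ℂ := Pi.single y 1

theorem op_ext {A B : Op n} (h : ∀ y, A.mulVec (ket y) = B.mulVec (ket y)) : A = B := by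
  ext x y
  simpa [ket] using congrFun (h y) x

theorem phase_mulVec_ket (g : Basis n → ℝ) (y : Basis n) :
    (phase g).mulVec (ket y) = Complex.exp (Complex.I * Real.pi * (g y : ℂ)) • ket y := by
  ext x
  by_cases h : x = y
  · subst h; simp [phase, ket]
  · simp [phase, ket, h]

theorem ofBasisMap_mulVec_ket (f : Basis n → Basis n) (y : Basis n) :
    (ofBasisMap f).mulVec (ket y) = ket (f y) := by
  ext x
  simp [ofBasisMap, ket, Pi.single_apply]

theorem onQubit_mulVec_ket (U : Matrix (Fin 2) (Fin 2) ℂ) (q : Fin n) (y : Basis n) :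
    (onQubit U q).mulVec (ket y) = ∑ b, U b (y q) • ket (Function.update y q b) := by
  ext x
  simp only [ket, Matrix.mulVec_single, MulOpposite.op_one, one_smul, Matrix.col_apply, onQubit,
    Finset.sum_apply, Pi.smul_apply, Pi.single_apply, smul_eq_mul, mul_ite, mul_one, mul_zero]
  by_cases h : ∀ j, j ≠ q → x j = y j
  · have hx : ∀ b, x = Function.update y q b ↔ x q = b := fun b => by
      constructor
      · intro h; rw [h]; simp
      · rintro rfl
        ext j
        by_cases hj : j = q
        · subst hj; simp
        · simp [hj, h j hj]
    simp [hx, if_pos h]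
  · rw [if_neg h]
    refine (Finset.sum_eq_zero fun b _ => if_neg fun hb => h fun j hj => ?_).symm
    rw [hb]; simp [hj]

theorem hadamard_apply (u v : Fin 2) : hadamard u v =
    ((1 / Real.sqrt 2 : ℝ) : ℂ) * Complex.exp (Complex.I * Real.pi * ((u.val * v.val : ℝ) : ℂ)) := by
  fin_cases u <;> fin_cases v <;>
    simp [hadamard, mul_comm Complex.I, Complex.exp_pi_mul_I]

/-- The Hadamard gate on qubit `q`. -/
def had (q : Fin n) : Op n := onQubit hadamard q

theorem hadamard_mul_hadamard (u v : Fin 2) :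
    ∑ b, hadamard u b * hadamard b v = if u = v then 1 else 0 := by
  have h : ((Real.sqrt 2 : ℝ) : ℂ)⁻¹ * ((Real.sqrt 2 : ℝ) : ℂ)⁻¹ = 1 / 2 := by
    rw [← mul_inv, ← Complex.ofReal_mul, Real.mul_self_sqrt (by norm_num)]; norm_num
  fin_cases u <;> fin_cases v <;> simp [hadamard, h] <;> norm_num

theorem had_mul_had (q : Fin n) : had q * had q = 1 := by
  refine op_ext fun y => ?_
  rw [← Matrix.mulVec_mulVec, had, onQubit_mulVec_ket, Matrix.mulVec_sum, Matrix.one_mulVec]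
  simp only [Matrix.mulVec_smul, onQubit_mulVec_ket, Function.update_self, Function.update_idem,
    Finset.smul_sum, smul_smul]
  rw [Finset.sum_comm]
  simp only [← Finset.sum_smul, mul_comm (hadamard _ (y q)), hadamard_mul_hadamard]
  simp

theorem phase_mul_had {g : Basis n → ℝ} {q : Fin n}
    (hg : ∀ y b, g (Function.update y q b) = g y) : phase g * had q = had q * phase g := by
  refine op_ext fun y => ?_
  simp only [← Matrix.mulVec_mulVec, had, onQubit_mulVec_ket, Matrix.mulVec_sum,
    Matrix.mulVec_smul, phase_mulVec_ket, hg, Finset.smul_sum, smul_smul, mul_comm]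

theorem phase_mul_ofBasisMap (g : Basis n → ℝ) (f : Basis n → Basis n) :
    phase g * ofBasisMap f = ofBasisMap f * phase (g ∘ f) := by
  refine op_ext fun y => ?_
  simp only [← Matrix.mulVec_mulVec, ofBasisMap_mulVec_ket, Matrix.mulVec_smul, phase_mulVec_ket,
    Function.comp_apply]

theorem ofBasisMap_mul (f g : Basis n → Basis n) :
    ofBasisMap f * ofBasisMap g = ofBasisMap (f ∘ g) := by
  refine op_ext fun y => ?_
  simp only [← Matrix.mulVec_mulVec, ofBasisMap_mulVec_ket, Function.comp_apply]

theorem ofBasisMap_id : ofBasisMap (id : Basis n → Basis n) = 1 := by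
  refine op_ext fun y => ?_
  simp only [ofBasisMap_mulVec_ket, Matrix.one_mulVec, id]

theorem phase_neg_mul (g : Basis n → ℝ) : phase (-g) * phase g = 1 := by
  rw [phase_mul, neg_add_cancel, phase_zero]

theorem phase_mul_neg (g : Basis n → ℝ) : phase g * phase (-g) = 1 := by
  rw [phase_mul, add_neg_cancel, phase_zero]

theorem phase_comm (g h : Basis n → ℝ) : phase g * phase h = phase h * phase g := by
  rw [phase_mul, phase_mul, add_comm]

/-! ### Operators realizable in a given number of cycles -/

/-- The operator has a circuit that can be executed in `d` phase cycles. -/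
def Realizable (d : ℕ) (U : Op n) : Prop := ∃ C : Circuit n, C.toOp = U ∧ C.Executable d

theorem Realizable.mul {d e : ℕ} {U V : Op n} (hU : Realizable d U) (hV : Realizable e V) :
    Realizable (d + e) (U * V) := by
  obtain ⟨C, rfl, hC⟩ := hU
  obtain ⟨D, rfl, hD⟩ := hV
  exact ⟨D ++ C, Circuit.toOp_append D C, add_comm e d ▸ hD.append hC⟩

theorem Realizable.mono {d e : ℕ} {U : Op n} (hU : Realizable d U) (h : d ≤ e) :
    Realizable e U := by
  obtain ⟨C, rfl, hC⟩ := hU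
  exact ⟨C, rfl, hC.mono h⟩

theorem realizable_one : Realizable 0 (1 : Op n) := ⟨[], rfl, Circuit.executable_nil⟩

theorem realizable_had (q : Fin n) : Realizable 0 (had q) :=
  ⟨[Gate.H q], by simp [Circuit.toOp, Gate.toOp, had],
    Circuit.executable_zero (by simp [Gate.phaseCost])⟩

/-- The basis map of a CNOT gate. -/
def cnot (c t : Fin n) (y : Basis n) : Basis n := Function.update y t (y t + y c)

theorem realizable_cnot {c t : Fin n} (h : c ≠ t) : Realizable 0 (ofBasisMap (cnot c t)) :=
  ⟨[Gate.CNOT c t h], by simp only [Circuit.toOp, Gate.toOp, Matrix.one_mul]; rfl,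
    Circuit.executable_zero (by simp [Gate.phaseCost])⟩

theorem cnot_cnot {c t : Fin n} (h : c ≠ t) (y : Basis n) : cnot c t (cnot c t y) = y := by
  have h2 : ∀ u v : Fin 2, u + v + v = u := by decide
  simp [cnot, h, h2]

/-- A basis map that is computed, and inverted, by CNOT gates. -/
def IsCNOTMap (f : Basis n → Basis n) : Prop :=
  ∃ g : Basis n → Basis n,
    Realizable 0 (ofBasisMap f) ∧ Realizable 0 (ofBasisMap g) ∧ g ∘ f = id

theorem isCNOTMap_id : IsCNOTMap (id : Basis n → Basis n) :=
  ⟨id, ofBasisMap_id ▸ realizable_one, ofBasisMap_id ▸ realizable_one, rfl⟩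

theorem IsCNOTMap.cnot_comp {f : Basis n → Basis n} (hf : IsCNOTMap f) {c t : Fin n}
    (h : c ≠ t) : IsCNOTMap (cnot c t ∘ f) := by
  obtain ⟨g, h1, h2, h3⟩ := hf
  refine ⟨g ∘ cnot c t, ?_, ?_, ?_⟩
  · rw [← ofBasisMap_mul]; exact (realizable_cnot h).mul h1
  · rw [← ofBasisMap_mul]; exact h2.mul (realizable_cnot h)
  · funext y
    simp only [Function.comp_apply, cnot_cnot h]
    exact congrFun h3 y

/-- The basis map that adds bit `c` to every bit in `A`. -/
def fan (c : Fin n) (A : Finset (Fin n)) (y : Basis n) : Basis n :=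
  fun i => if i ∈ A then y i + y c else y i

theorem isCNOTMap_fan (c : Fin n) (A : Finset (Fin n)) (hc : c ∉ A) : IsCNOTMap (fan c A) := by
  induction A using Finset.induction_on with
  | empty =>
    convert isCNOTMap_id using 1
    funext y i
    simp [fan]
  | insert a A ha ih =>
    rw [Finset.mem_insert, not_or] at hc
    convert (ih hc.2).cnot_comp hc.1 using 1
    funext y i
    by_cases hi : i = a
    · subst hi; simp [fan, cnot, ha, hc.2]
    · simp [fan, cnot, hi]

/-- The multiples of `π` by which a phase gate, or no gate, shifts the phase. -/
def IsPhaseAngle (a : ℝ) : Prop :=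
  a = 0 ∨ ∃ k : ℕ, 1 ≤ k ∧ (a = (2 ^ k : ℝ)⁻¹ ∨ a = -(2 ^ k : ℝ)⁻¹)

theorem IsPhaseAngle.zero : IsPhaseAngle 0 := Or.inl rfl

theorem IsPhaseAngle.neg {a : ℝ} (h : IsPhaseAngle a) : IsPhaseAngle (-a) := by
  rcases h with rfl | ⟨k, hk, rfl | rfl⟩
  · simp [IsPhaseAngle]
  · exact Or.inr ⟨k, hk, Or.inr rfl⟩
  · exact Or.inr ⟨k, hk, Or.inl (neg_neg _)⟩

theorem IsPhaseAngle.two_pow_div {l j : ℕ} (h : l < j) : IsPhaseAngle (2 ^ l / 2 ^ j) := by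
  refine Or.inr ⟨j - l, by omega, Or.inl ?_⟩
  rw [div_eq_iff (by positivity), inv_mul_eq_div, eq_div_iff (by positivity), ← pow_add]
  congr 1; omega

theorem realizable_phase_one_qubit {a : ℝ} (ha : IsPhaseAngle a) (q : Fin n) :
    ∃ C : Circuit n, C.toOp = phase (fun y => a * ((y q).val : ℝ)) ∧ C.length ≤ 1 ∧
      ∀ g ∈ C, g.support = {q} := by
  rcases ha with rfl | ⟨k, hk, rfl | rfl⟩
  · refine ⟨[], ?_, by simp, by simp⟩
    simp only [zero_mul, Circuit.toOp]
    exact phase_zero.symm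
  · exact ⟨[Gate.Z k hk q], by simp only [Circuit.toOp, Matrix.one_mul, Gate.toOp_Z], by simp,
      by simp [Gate.support]⟩
  · exact ⟨[Gate.Zdag k hk q], by simp only [Circuit.toOp, Matrix.one_mul, Gate.toOp_Zdag],
      by simp, by simp [Gate.support]⟩

/-- One cycle executes a phase gate on every qubit. -/
theorem realizable_phase_cycle {a : Fin n → ℝ} (ha : ∀ q, IsPhaseAngle (a q)) :
    Realizable 1 (phase fun y : Basis n => ∑ q, a q * ((y q).val : ℝ)) := by
  choose C h1 h2 h3 using fun q => realizable_phase_one_qubit (ha q) q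
  refine ⟨(List.finRange n).flatMap C, ?_, Circuit.executable_one ?_⟩
  · have : ∀ l : List (Fin n), Circuit.toOp (l.flatMap C) =
        phase fun y => (l.map fun q => a q * ((y q).val : ℝ)).sum := by
      intro l
      induction l with
      | nil => exact phase_zero.symm
      | cons q l ih =>
        rw [List.flatMap_cons, Circuit.toOp_append, ih, h1, phase_mul]
        congr 1
        ext y
        simp [add_comm]
    rw [this]
    simp only [← List.ofFn_eq_map, List.sum_ofFn]
  · rw [List.pairwise_flatMap]
    refine ⟨fun q _ => ?_, ?_⟩
    · have h := h2 q
      match hC : C q with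
      | [] => exact List.Pairwise.nil
      | [g] => exact List.pairwise_singleton _ _
      | g :: g' :: l => rw [hC] at h; simp at h
    · refine (List.nodup_finRange n).imp ?_
      intro q q' hq g hg g' hg'
      rw [h3 q g hg, h3 q' g' hg']
      simpa using hq

/-- One cycle executes phase gates on the bits computed by CNOT gates. -/
theorem IsCNOTMap.realizable_phase {f : Basis n → Basis n} (hf : IsCNOTMap f) {a : Fin n → ℝ}
    (ha : ∀ q, IsPhaseAngle (a q)) :
    Realizable 1 (phase fun y => ∑ q, a q * ((f y q).val : ℝ)) := by
  obtain ⟨g, h1, h2, h3⟩ := hf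
  -- Compute `f`, apply one-qubit phases, uncompute with `g`; both CNOT parts are free.
  have := (h2.mul (realizable_phase_cycle ha)).mul h1
  rw [Matrix.mul_assoc, phase_mul_ofBasisMap, ← Matrix.mul_assoc, ofBasisMap_mul, h3,
    ofBasisMap_id, Matrix.one_mul] at this
  exact this

/-- Read backwards, 2uv = u + v - (u ⊕ v) turns a controlled phase into phases on two bits and on
their parity. -/
theorem val_add (u v : Fin 2) :
    ((u + v).val : ℝ) = (u.val : ℝ) + v.val - 2 * (u.val * v.val) := by
  fin_cases u <;> fin_cases v <;> (simp; try norm_num)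

theorem val_mul (u v : Fin 2) : ((u * v).val : ℝ) = (u.val : ℝ) * v.val := by
  fin_cases u <;> fin_cases v <;> simp

theorem exp_val_add (u v : Fin 2) :
    Complex.exp (Complex.I * Real.pi * (((u + v).val : ℝ) : ℂ)) =
      Complex.exp (Complex.I * Real.pi * ((u.val : ℝ) : ℂ)) *
        Complex.exp (Complex.I * Real.pi * ((v.val : ℝ) : ℂ)) := by
  fin_cases u <;> fin_cases v <;> simp [mul_comm Complex.I, Complex.exp_pi_mul_I]

/-! ### The controlled increment and its Fourier transform -/

variable {m : ℕ}

/-- The product of the bits below position `k`. -/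
def lowProd (k : ℕ) (y : Basis (m + 1)) : Fin 2 := ∏ l with l.val < k, y l

/-- The increment of the integer with the bits `1, …, j`, least significant bit first,
controlled by bit `0`. -/
def inc (j : ℕ) (y : Basis (m + 1)) : Basis (m + 1) :=
  fun i => if 1 ≤ i.val ∧ i.val ≤ j then y i + lowProd i.val y else y i

/-- Twice the integer with the bits `1, …, k - 1`. -/
def lowSum (k : ℕ) (y : Basis (m + 1)) : ℝ :=
  ∑ l : Fin (m + 1), if 1 ≤ l.val ∧ l.val < k then 2 ^ l.val * ((y l).val : ℝ) else 0

theorem lowProd_one (y : Basis (m + 1)) : lowProd 1 y = y 0 := by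
  rw [lowProd, Finset.prod_eq_single_of_mem 0 (by simp)]
  intro b hb hb0
  simp only [Finset.mem_filter, Finset.mem_univ, true_and] at hb
  exact absurd (Fin.ext (by simpa using hb)) hb0

theorem lowProd_succ (j : Fin (m + 1)) (y : Basis (m + 1)) :
    lowProd (j.val + 1) y = lowProd j.val y * y j := by
  have : (Finset.univ.filter fun l : Fin (m + 1) => l.val < j.val + 1) =
      insert j (Finset.univ.filter fun l : Fin (m + 1) => l.val < j.val) := by
    ext l
    simp only [Finset.mem_filter, Finset.mem_univ, true_and, Finset.mem_insert, Fin.ext_iff]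
    omega
  rw [lowProd, lowProd, this, Finset.prod_insert (by simp), mul_comm]

theorem sum_lt_succ (j : Fin (m + 1)) (hj : 1 ≤ j.val) (f : Fin (m + 1) → ℝ) :
    (∑ l : Fin (m + 1), if 1 ≤ l.val ∧ l.val < j.val + 1 then f l else 0) =
      (∑ l : Fin (m + 1), if 1 ≤ l.val ∧ l.val < j.val then f l else 0) + f j := by
  have h : ∀ l : Fin (m + 1), (if 1 ≤ l.val ∧ l.val < j.val + 1 then f l else 0) =
      (if 1 ≤ l.val ∧ l.val < j.val then f l else 0) + if l = j then f l else 0 := by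
    intro l
    by_cases h : l = j
    · subst h; simp [hj]
    · have : l.val ≠ j.val := fun h' => h (Fin.ext h')
      have h2 : (1 ≤ l.val ∧ l.val < j.val + 1) ↔ (1 ≤ l.val ∧ l.val < j.val) := by omega
      rw [if_neg h, add_zero]
      exact if_congr h2 rfl rfl
  simp only [h, Finset.sum_add_distrib, Finset.sum_ite_eq', Finset.mem_univ, if_true]

theorem lowProd_update {k : ℕ} (y : Basis (m + 1)) (j : Fin (m + 1)) (hk : k ≤ j.val) (b : Fin 2) :
    lowProd k (Function.update y j b) = lowProd k y := by
  refine Finset.prod_congr rfl fun l hl => Function.update_of_ne (fun h => ?_) _ _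
  subst h
  simp only [Finset.mem_filter] at hl
  omega

theorem lowSum_update {k : ℕ} (y : Basis (m + 1)) (j : Fin (m + 1)) (hk : k ≤ j.val) (b : Fin 2) :
    lowSum k (Function.update y j b) = lowSum k y := by
  refine Finset.sum_congr rfl fun l _ => ?_
  by_cases h : l = j
  · subst h
    rw [if_neg (by omega), if_neg (by omega)]
  · rw [Function.update_of_ne h]

/-- The increment adds one up to the carry. -/
theorem lowSum_inc (j k : ℕ) (hk1 : 1 ≤ k) (hkj : k ≤ j + 1) (hkm : k ≤ m + 1)
    (y : Basis (m + 1)) :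
    lowSum k (inc j y) = lowSum k y + 2 * ((y 0).val : ℝ) - 2 ^ k * ((lowProd k y).val : ℝ) := by
  induction k, hk1 using Nat.le_induction with
  | base =>
    have : ∀ z : Basis (m + 1), lowSum 1 z = 0 := fun z =>
      Finset.sum_eq_zero fun l _ => if_neg (by omega)
    rw [this, this, lowProd_one]; ring
  | succ k hk ih =>
    have h := ih (by omega) (by omega)
    obtain ⟨q, rfl⟩ : ∃ q : Fin (m + 1), q.val = k := ⟨⟨k, by omega⟩, rfl⟩
    have hs : ∀ z : Basis (m + 1), lowSum (q.val + 1) z =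
        lowSum q.val z + 2 ^ q.val * ((z q).val : ℝ) := fun z => sum_lt_succ q hk _
    rw [hs, hs, h, lowProd_succ, val_mul]
    have : inc j y q = y q + lowProd q.val y := if_pos (by omega)
    rw [this, val_add]
    ring

theorem inc_zero_apply (j : ℕ) (y : Basis (m + 1)) : inc j y 0 = y 0 := if_neg (by simp)

theorem inc_of_lt {j : ℕ} {i : Fin (m + 1)} (h : j < i.val) (y : Basis (m + 1)) :
    inc j y i = y i := if_neg (by omega)

/-- Carries into positions up to `j` never involve bit `j`, so overwriting that bit erases the
difference between the two increments. This handles the Hadamard gate, which sums over both values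
of bit `j`. -/
theorem inc_update (j : Fin (m + 1)) (hj : 1 ≤ j.val) (y : Basis (m + 1)) (b : Fin 2) :
    inc (j.val - 1) (Function.update y j b) = Function.update (inc j.val y) j b := by
  ext i
  by_cases hi : i = j
  · subst hi
    rw [inc_of_lt (by omega)]; simp
  · have hne : i.val ≠ j.val := fun h => hi (Fin.ext h)
    rw [Function.update_of_ne hi]
    by_cases h : 1 ≤ i.val ∧ i.val ≤ j.val
    · rw [inc, if_pos (by omega), inc, if_pos h, Function.update_of_ne hi,
        lowProd_update _ _ (by omega)]
    · rw [inc, if_neg (by omega), inc, if_neg h, Function.update_of_ne hi]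

/-- The exponent of the controlled phases that follow the Hadamard gate of qubit `j` in the
Fourier transform. -/
def fourierPhase (j : Fin (m + 1)) (y : Basis (m + 1)) : ℝ :=
  ((y j).val : ℝ) * lowSum j.val y / 2 ^ j.val

/-- The exponent of the phase shift of qubit `j` controlled by qubit `0`. -/
def shiftPhase (j : Fin (m + 1)) (y : Basis (m + 1)) : ℝ :=
  2 * ((y j).val : ℝ) * ((y 0).val : ℝ) / 2 ^ j.val

/-- The carry into bit `j` enters twice: in the Hadamard sign, and as the overflow of the lower bits
(`lowSum_inc`). The two contributions cancel, leaving a shift controlled by bit 0. -/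
theorem fourier_mul_inc (j : Fin (m + 1)) (hj : 1 ≤ j.val) :
    phase (fourierPhase j) * had j * ofBasisMap (inc j.val) =
      phase (shiftPhase j) * ofBasisMap (inc (j.val - 1)) * phase (fourierPhase j) * had j := by
  have hj0 : (0 : Fin (m + 1)) ≠ j := fun h => by rw [← h] at hj; simp at hj
  refine op_ext fun y => ?_
  simp only [← Matrix.mulVec_mulVec, ofBasisMap_mulVec_ket, had, onQubit_mulVec_ket,
    Matrix.mulVec_sum, Matrix.mulVec_smul, phase_mulVec_ket, smul_smul, inc_update j hj]
  refine Finset.sum_congr rfl fun b _ => ?_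
  congr 1
  have h1 : inc j.val y j = y j + lowProd j.val y := if_pos (by omega)
  have h2 := lowSum_inc j.val j.val hj (by omega) (by omega) y
  rw [h1, hadamard_apply, hadamard_apply, fourierPhase, fourierPhase, shiftPhase,
    lowSum_update _ _ le_rfl, lowSum_update _ _ le_rfl, h2]
  simp only [Function.update_self, Function.update_of_ne hj0, inc_zero_apply]
  have hb : b = 0 ∨ b = 1 := by fin_cases b <;> simp
  rcases hb with rfl | rfl
  · simp
  · simp only [Fin.val_one, Nat.cast_one, one_mul, mul_one]
    rw [exp_val_add]
    have h3 : (lowSum j.val y + 2 * ((y 0).val : ℝ) -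
        2 ^ j.val * ((lowProd j.val y).val : ℝ)) / 2 ^ j.val =
        lowSum j.val y / 2 ^ j.val + 2 * ((y 0).val : ℝ) / 2 ^ j.val -
          ((lowProd j.val y).val : ℝ) := by
      field_simp
    rw [h3]
    push_cast
    simp only [mul_sub, mul_add, Complex.exp_sub, Complex.exp_add]
    field_simp [Complex.exp_ne_zero]

theorem inc_eq_fourier (j : Fin (m + 1)) (hj : 1 ≤ j.val) :
    ofBasisMap (inc j.val) = had j * phase (-fourierPhase j) * (phase (shiftPhase j) *
      ofBasisMap (inc (j.val - 1))) * (phase (fourierPhase j) * had j) := by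
  have h := congrArg (fun A => had j * phase (-fourierPhase j) * A) (fourier_mul_inc j hj)
  simp only [Matrix.mul_assoc] at h ⊢
  rw [← h, ← Matrix.mul_assoc (phase (-fourierPhase j)), phase_neg_mul, Matrix.one_mul,
    ← Matrix.mul_assoc (had j), had_mul_had, Matrix.one_mul]

/-! ### Fourier phases as parity phases -/

/-- The exponent of a phase cycle: the parities of bit `j` with the bits `1, …, j - 1`, and
the bit `j - 1`. -/
def stagePhase (c : ℕ → ℝ) (j : Fin (m + 1)) (y : Basis (m + 1)) : ℝ :=
  ∑ l : Fin (m + 1), ((if 1 ≤ l.val ∧ l.val < j.val then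
      -(2 ^ l.val / 2 ^ (j.val + 1)) * ((y l + y j).val : ℝ) else 0) +
    if 1 ≤ l.val ∧ l.val + 1 = j.val then c l.val * ((y l).val : ℝ) else 0)

/-- The exponent of the one-qubit phases collected in front of the stages `1, …, k`. -/
def prePhase (c : ℕ → ℝ) (k : ℕ) (y : Basis (m + 1)) : ℝ :=
  ∑ l : Fin (m + 1), if 1 ≤ l.val ∧ l.val < k then
    (1 / 2 - 2 ^ l.val / 2 ^ (k + 1) - c l.val) * ((y l).val : ℝ) else 0

/-- Each product of bits `l` and `j` splits into a parity and one-qubit phases. Those on bit `j`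
form `κ`; those on lower bits accumulate in `prePhase`, as the sum of 2^l / 2^(i+1) over l < i ≤ k
is 1/2 - 2^l / 2^(k+1). The free parameter `c l` moves part of the phase on bit `l` into stage `l +
1`. -/
theorem fourierPhase_eq (c : ℕ → ℝ) (j : Fin (m + 1)) (hj : 1 ≤ j.val) :
    ∃ κ : ℝ, (fourierPhase j : Basis (m + 1) → ℝ) = stagePhase c j + (fun y => κ * ((y j).val : ℝ)) +
      (prePhase c j.val - prePhase c (j.val - 1)) := by
  refine ⟨∑ l : Fin (m + 1), if 1 ≤ l.val ∧ l.val < j.val then 2 ^ l.val / 2 ^ (j.val + 1) else 0,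
    ?_⟩
  ext y
  simp only [fourierPhase, lowSum, stagePhase, prePhase, Pi.add_apply, Pi.sub_apply,
    Finset.sum_mul, Finset.mul_sum, Finset.sum_div, ← Finset.sum_add_distrib,
    ← Finset.sum_sub_distrib]
  refine Finset.sum_congr rfl fun l _ => ?_
  obtain ⟨k, hk⟩ : ∃ k, j.val = k + 1 := ⟨j.val - 1, by omega⟩
  rw [hk, Nat.add_sub_cancel]
  by_cases h1 : 1 ≤ l.val ∧ l.val < k
  · rw [if_pos (by omega), if_pos (by omega), if_neg (by omega), if_pos (by omega),
      if_pos (by omega), if_pos h1, val_add]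
    simp only [pow_succ]
    field_simp
    ring
  · by_cases h2 : 1 ≤ l.val ∧ l.val = k
    · rw [if_pos (by omega), if_pos (by omega), if_pos (by omega), if_pos (by omega),
        if_pos (by omega), if_neg h1, val_add, h2.2]
      simp only [pow_succ]
      field_simp
      ring
    · rw [if_neg (by omega), if_neg (by omega), if_neg (by omega), if_neg (by omega),
        if_neg (by omega), if_neg h1]
      simp

/-- The stages `j, …, 1`, the diagonal operator with exponent `p`, and the inverse stages. -/
def conj (c : ℕ → ℝ) (p : Basis (m + 1) → ℝ) : ℕ → Op (m + 1)
  | 0 => phase p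
  | j + 1 => had (Fin.ofNat (m + 1) (j + 1)) * phase (-stagePhase c (Fin.ofNat (m + 1) (j + 1))) *
      conj c p j * (phase (stagePhase c (Fin.ofNat (m + 1) (j + 1))) *
        had (Fin.ofNat (m + 1) (j + 1)))

/-- The stages between the two diagonal operators cancel: this is conjugation by a fixed operator.
-/
theorem conj_mul (c : ℕ → ℝ) (p q : Basis (m + 1) → ℝ) (j : ℕ) :
    conj c p j * conj c q j = conj c (p + q) j := by
  induction j with
  | zero => exact phase_mul p q
  | succ j ih =>
    simp only [conj, ← ih, Matrix.mul_assoc]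
    rw [← Matrix.mul_assoc (had _) (had _), had_mul_had, Matrix.one_mul,
      ← Matrix.mul_assoc (phase (stagePhase _ _)) (phase (-stagePhase _ _)), phase_mul_neg,
      Matrix.one_mul]

theorem conj_zero (c : ℕ → ℝ) (j : ℕ) : conj c (0 : Basis (m + 1) → ℝ) j = 1 := by
  induction j with
  | zero => exact phase_zero
  | succ j ih =>
    simp only [conj, ih, Matrix.mul_assoc, Matrix.one_mul]
    rw [← Matrix.mul_assoc (phase (-stagePhase _ _)) (phase (stagePhase _ _)), phase_neg_mul,
      Matrix.one_mul, had_mul_had]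

/-- Phases that do not involve the transformed bits commute with the stages. -/
theorem conj_of_indep (c : ℕ → ℝ) (p : Basis (m + 1) → ℝ) (j : ℕ) (hjm : j ≤ m)
    (hp : ∀ i : Fin (m + 1), 1 ≤ i.val → i.val ≤ j → ∀ y b, p (Function.update y i b) = p y) :
    conj c p j = phase p := by
  induction j with
  | zero => rfl
  | succ j ih =>
    have hv : (Fin.ofNat (m + 1) (j + 1)).val = j + 1 := by
      simp only [Fin.ofNat]; exact Nat.mod_eq_of_lt (by omega)
    rw [conj, ih (by omega) (fun i h1 h2 => hp i h1 (by omega))]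
    have h := phase_mul_had (hp _ (by rw [hv]; omega) hv.le)
    simp only [Matrix.mul_assoc]
    rw [← Matrix.mul_assoc (phase p), phase_comm p, Matrix.mul_assoc, h,
      ← Matrix.mul_assoc (phase (-stagePhase _ _)), phase_neg_mul, Matrix.one_mul,
      ← Matrix.mul_assoc, had_mul_had, Matrix.one_mul]

/-- The exponent of the diagonal operator in the middle: the controlled phase shifts of the
qubits `1, …, k`, up to a phase on qubit `0`. -/
def midPhase (k : ℕ) (y : Basis (m + 1)) : ℝ :=
  ∑ l : Fin (m + 1), if 1 ≤ l.val ∧ l.val < k + 1 then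
    (((y l).val : ℝ) - ((y l + y 0).val : ℝ)) / 2 ^ l.val else 0

/-- The controlled shift exceeds its parity form by y_0 / 2^j. These surpluses sum to the
coefficient 1 - 1/2^k in `inc_eq_conj`. -/
theorem midPhase_succ (j : Fin (m + 1)) (hj : 1 ≤ j.val) :
    (midPhase j.val : Basis (m + 1) → ℝ) = midPhase (j.val - 1) +
      (shiftPhase j + fun y => -(1 / 2 ^ j.val) * ((y 0).val : ℝ)) := by
  ext y
  simp only [midPhase, Pi.add_apply]
  rw [sum_lt_succ j hj, Nat.sub_add_cancel hj, val_add, shiftPhase]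
  ring

theorem conj_comm (c : ℕ → ℝ) (p q : Basis (m + 1) → ℝ) (j : ℕ) :
    conj c p j * conj c q j = conj c q j * conj c p j := by
  rw [conj_mul, conj_mul, add_comm p q]

theorem prePhase_update (c : ℕ → ℝ) {k : ℕ} (y : Basis (m + 1)) (j : Fin (m + 1))
    (hk : k ≤ j.val) (b : Fin 2) : prePhase c k (Function.update y j b) = prePhase c k y := by
  refine Finset.sum_congr rfl fun l _ => ?_
  by_cases h : l = j
  · subst h
    rw [if_neg (by omega), if_neg (by omega)]
  · rw [Function.update_of_ne h]

/-- The increment is a conjugated diagonal operator up to one-qubit phases. -/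
theorem inc_eq_conj (c : ℕ → ℝ) (k : ℕ) (hk : k ≤ m) :
    (ofBasisMap (inc k) : Op (m + 1)) =
      phase ((fun y => (1 - 1 / 2 ^ k) * ((y 0).val : ℝ)) - prePhase c k) * conj c (midPhase k) k *
        phase (prePhase c k) := by
  induction k with
  | zero =>
    have h1 : (inc 0 : Basis (m + 1) → Basis (m + 1)) = id := by
      funext y i; exact if_neg (by omega)
    rw [h1, ofBasisMap_id, conj, phase_mul, phase_mul, ← phase_zero]
    congr 1
    ext y
    have : midPhase 0 y = 0 := Finset.sum_eq_zero fun l _ => if_neg (by omega)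
    simp [this]
  | succ k ih =>
    have hv : (Fin.ofNat (m + 1) (k + 1)).val = k + 1 := by
      simp only [Fin.ofNat]; exact Nat.mod_eq_of_lt (by omega)
    have ih := ih (by omega)
    rw [conj]
    generalize Fin.ofNat (m + 1) (k + 1) = j at hv
    obtain rfl : k = j.val - 1 := by omega
    have hj : 1 ≤ j.val := by omega
    have hj0 : (0 : Fin (m + 1)) ≠ j := fun h => by rw [← h] at hj; simp at hj
    rw [Nat.sub_add_cancel hj]
    obtain ⟨κ, hκ⟩ := fourierPhase_eq c j hj
    rw [inc_eq_fourier j hj, ih, midPhase_succ j hj]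
    set K := conj c (midPhase (j.val - 1)) (j.val - 1) with hK
    set r : Basis (m + 1) → ℝ := shiftPhase j + fun y => -(1 / 2 ^ j.val) * ((y 0).val : ℝ)
      with hr
    set t : Basis (m + 1) → ℝ := fun y => κ * ((y j).val : ℝ) with ht
    set e : Basis (m + 1) → ℝ := fun y => (1 - 1 / 2 ^ j.val) * ((y 0).val : ℝ) with he
    have hindep : ∀ p : Basis (m + 1) → ℝ,
        (∀ (i : Fin (m + 1)) (y : Basis (m + 1)) (b : Fin 2), i ≠ 0 → i ≠ j →
          p (Function.update y i b) = p y) →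
        conj c p (j.val - 1) = phase p := fun p hp => conj_of_indep c p _ (by omega)
      fun i h1 h2 y b => hp i y b (fun h => by rw [h] at h1; simp at h1)
        (fun h => by rw [h] at h2; omega)
    have hrK : conj c (midPhase (j.val - 1) + r) (j.val - 1) = phase r * K := by
      rw [add_comm (midPhase _) r, ← conj_mul, hindep r fun i y b h0 hi => by
        simp [hr, shiftPhase, Function.update_of_ne h0.symm, Function.update_of_ne hi.symm]]
    -- The inner stages act on bits below `j` only, so the phase on bit `j` commutes past them and
    -- its two copies cancel.
    have htK : phase (-t) * K * phase t = K := by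
      have h1 : conj c t (j.val - 1) = phase t := hindep t fun i y b h0 hi => by
        simp [ht, Function.update_of_ne hi.symm]
      rw [Matrix.mul_assoc, hK, ← h1, conj_comm, h1, ← Matrix.mul_assoc, phase_neg_mul,
        Matrix.one_mul]
    have hpre : phase (prePhase c j.val) * had j = had j * phase (prePhase c j.val) :=
      phase_mul_had fun y b => prePhase_update c y j le_rfl b
    have hepre : phase (e - prePhase c j.val) * had j = had j * phase (e - prePhase c j.val) :=
      phase_mul_had fun y b => by
        simp [he, prePhase_update c y j le_rfl b, Function.update_of_ne hj0]
    have hleft : phase (-fourierPhase j) * (phase (shiftPhase j) *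
        phase ((fun y => (1 - 1 / 2 ^ (j.val - 1)) * ((y 0).val : ℝ)) - prePhase c (j.val - 1))) =
        phase (e - prePhase c j.val) * (phase (-stagePhase c j) * (phase r * phase (-t))) := by
      simp only [phase_mul]
      congr 1
      ext y
      have h2 : (1 : ℝ) / 2 ^ (j.val - 1) = 2 / 2 ^ j.val := by
        obtain ⟨k, hk⟩ : ∃ k, j.val = k + 1 := ⟨j.val - 1, by omega⟩
        rw [hk, Nat.add_sub_cancel, pow_succ]; field_simp
      simp only [hκ, he, hr, Pi.add_apply, Pi.sub_apply, Pi.neg_apply, h2]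
      ring
    have hright : phase (prePhase c (j.val - 1)) * phase (fourierPhase j) =
        phase t * (phase (stagePhase c j) * phase (prePhase c j.val)) := by
      simp only [phase_mul, hκ]
      congr 1
      abel
    calc _ = had j * (phase (-fourierPhase j) * (phase (shiftPhase j) *
        phase ((fun y => (1 - 1 / 2 ^ (j.val - 1)) * ((y 0).val : ℝ)) - prePhase c (j.val - 1)))) *
        K * (phase (prePhase c (j.val - 1)) * phase (fourierPhase j)) * had j := by
          simp only [Matrix.mul_assoc]
      _ = (had j * phase (e - prePhase c j.val)) * (phase (-stagePhase c j) * (phase r *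
          (phase (-t) * K * phase t))) * phase (stagePhase c j) *
            (phase (prePhase c j.val) * had j) := by
          rw [hleft, hright]; simp only [Matrix.mul_assoc]
      _ = _ := by
          rw [htK, hpre, ← hepre, hrK]; simp only [Matrix.mul_assoc]

/-- This `c` doubles the subtracted term: 1/2 - 2 · 2^l / 2^(m+1) = 1/2 - 2^l / 2^m, which vanishes
at l = m - 1. The long increment and the short decrement thus have the same outer phases. -/
theorem prePhase_eq (hm : 1 ≤ m) : (prePhase (fun l => 2 ^ l / 2 ^ (m + 1)) m : Basis (m + 1) → ℝ) =
    prePhase 0 (m - 1) := by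
  ext y
  refine Finset.sum_congr rfl fun l _ => ?_
  obtain ⟨k, rfl⟩ : ∃ k, m = k + 1 := ⟨m - 1, by omega⟩
  rw [Nat.add_sub_cancel]
  by_cases h1 : 1 ≤ l.val ∧ l.val < k
  · rw [if_pos h1, if_pos (by omega)]
    simp only [pow_succ, Pi.zero_apply]
    field_simp
    ring
  · rw [if_neg h1]
    split_ifs with h2
    · have h3 : l.val = k := by omega
      simp only [h3, pow_succ]
      field_simp
      ring
    · rfl

/-! ### Cancellation of the outer phases and the cycle count -/

/-- The multi-controlled Toffoli gate as a decrement after an increment. -/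
theorem mct_eq_conj_mul_conj (hm : 1 ≤ m) :
    mct (Fin.last m) = conj 0 (-midPhase (m - 1)) (m - 1) *
      conj (fun l => 2 ^ l / 2 ^ (m + 1))
        (midPhase m + fun y : Basis (m + 1) => 1 / 2 ^ m * ((y 0).val : ℝ)) m := by
  have hprod : ∀ y : Basis (m + 1), ∏ j ∈ Finset.univ.erase (Fin.last m), y j = lowProd m y := by
    intro y
    refine Finset.prod_congr ?_ fun _ _ => rfl
    ext l
    simp only [Finset.mem_erase, Finset.mem_univ, Finset.mem_filter, true_and, and_true, ne_eq,
      Fin.ext_iff, Fin.val_last]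
    omega
  set f : Basis (m + 1) → Basis (m + 1) := fun y =>
    Function.update y (Fin.last m) (y (Fin.last m) + ∏ j ∈ Finset.univ.erase (Fin.last m), y j)
    with hf
  have hlast : (Fin.last m).val = m := rfl
  -- The increments agree below the last bit, and the carry into the last bit is the product of the
  -- controls.
  have hinc : inc (m - 1) ∘ f = inc m := by
    funext y
    have h := inc_update (Fin.last m) hm y (y (Fin.last m) + lowProd m y)
    simp only [Function.comp_apply, hf, hprod, hlast] at h ⊢
    rw [h]
    refine Function.update_eq_self_iff.2 ?_
    exact (if_pos ⟨hm, le_rfl⟩).symm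
  set B : Basis (m + 1) → ℝ := prePhase 0 (m - 1) with hB
  set c : ℕ → ℝ := fun l => 2 ^ l / 2 ^ (m + 1) with hc
  set δ : Basis (m + 1) → ℝ := fun y => 1 / 2 ^ m * ((y 0).val : ℝ) with hδ
  set e : Basis (m + 1) → ℝ := fun y => (1 - 1 / 2 ^ (m - 1)) * ((y 0).val : ℝ) with he
  have h1 := inc_eq_conj (m := m) 0 (m - 1) (by omega)
  have h2 := inc_eq_conj (m := m) c m le_rfl
  rw [hc, prePhase_eq hm, ← hc] at h2
  have h3 : conj c (midPhase m + δ) m = phase δ * conj c (midPhase m) m := by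
    rw [add_comm (midPhase m) δ, ← conj_mul, conj_of_indep c δ m le_rfl]
    intro i hi _ y b
    have hi0 : (0 : Fin (m + 1)) ≠ i := fun h => by rw [← h] at hi; simp at hi
    simp [hδ, Function.update_of_ne hi0]
  -- The phases on qubit 0 differ by 1/2^(m-1) - 1/2^m = 1/2^m, which is `δ`.
  have h4 : phase ((fun y : Basis (m + 1) => (1 - 1 / 2 ^ m) * ((y 0).val : ℝ)) - B) =
      phase (e - B) * phase δ := by
    rw [phase_mul]
    congr 1
    ext y
    have h2 : (1 : ℝ) / 2 ^ (m - 1) = 2 / 2 ^ m := by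
      obtain ⟨k, hk⟩ : ∃ k, m = k + 1 := ⟨m - 1, by omega⟩
      rw [hk, Nat.add_sub_cancel, pow_succ]; field_simp
    simp only [he, hδ, Pi.add_apply, Pi.sub_apply, h2]
    ring
  have h5 : ofBasisMap (inc (m - 1)) * ofBasisMap f = ofBasisMap (inc m) := by
    rw [ofBasisMap_mul, hinc]
  have h6 : phase B * ofBasisMap f = ofBasisMap f * phase B := by
    rw [phase_mul_ofBasisMap]
    congr 2
    funext y
    exact prePhase_update 0 y (Fin.last m) (by rw [hlast]; omega) _
  have h7 : ofBasisMap f = phase (-B) * (conj 0 (-midPhase (m - 1)) (m - 1) *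
      (phase (-(e - B)) * (phase (e - B) * conj 0 (midPhase (m - 1)) (m - 1) * phase B *
        ofBasisMap f))) := by
    simp only [Matrix.mul_assoc]
    rw [← Matrix.mul_assoc (phase (-(e - B))), phase_neg_mul, Matrix.one_mul,
      ← Matrix.mul_assoc (conj _ _ _) (conj _ _ _), conj_mul, neg_add_cancel, conj_zero,
      Matrix.one_mul, ← Matrix.mul_assoc, phase_neg_mul, Matrix.one_mul]
  have h8 : ofBasisMap f = phase (-B) * (conj 0 (-midPhase (m - 1)) (m - 1) *
      conj c (midPhase m + δ) m) * phase B := by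
    refine h7.trans ?_
    rw [← h1, h5, h2, h4, h3]
    simp only [Matrix.mul_assoc]
    rw [← Matrix.mul_assoc (phase (-(e - B))), phase_neg_mul, Matrix.one_mul]
  -- `B` involves controls only and commutes with the gate, so conjugating by it removes the outer
  -- phases.
  have h9 := congrArg (fun A => phase B * A * phase (-B)) h8
  simp only [h6] at h9
  simp only [Matrix.mul_assoc, phase_mul_neg, Matrix.mul_one] at h9
  rw [← Matrix.mul_assoc (phase B), phase_mul_neg, Matrix.one_mul] at h9
  exact h9

/-- Bit 1 has no lower bits to meet, so the first stage costs no cycle. -/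
theorem stagePhase_one (c : ℕ → ℝ) (j : Fin (m + 1)) (hj : j.val = 1) :
    (stagePhase c j : Basis (m + 1) → ℝ) = 0 := by
  ext y
  refine Finset.sum_eq_zero fun l _ => ?_
  rw [if_neg (by omega), if_neg (by omega), add_zero]

/-- The exponent of a stage is a sum over the bits of a CNOT map. -/
theorem exists_stagePhase_eq (c : ℕ → ℝ) (hc : ∀ l, 1 ≤ l → l < m → IsPhaseAngle (c l))
    (j : Fin (m + 1)) (hj : 2 ≤ j.val) :
    ∃ (f : Basis (m + 1) → Basis (m + 1)) (a : Fin (m + 1) → ℝ), IsCNOTMap f ∧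
      (∀ q, IsPhaseAngle (a q)) ∧
      (stagePhase c j : Basis (m + 1) → ℝ) = fun y => ∑ q, a q * ((f y q).val : ℝ) := by
  obtain ⟨i, hi⟩ : ∃ i : Fin (m + 1), i.val + 1 = j.val := ⟨⟨j.val - 1, by omega⟩, by simp; omega⟩
  have hij : i ≠ j := fun h => by rw [h] at hi; omega
  set A : Finset (Fin (m + 1)) := Finset.univ.filter fun l => 1 ≤ l.val ∧ l.val < j.val with hA
  have hjA : j ∉ A := by simp [hA]
  have hiA : i ∈ A := by
    simp only [hA, Finset.mem_filter, Finset.mem_univ, true_and]; omega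
  -- After the fan, qubit `i = j - 1` holds y_i ⊕ y_j; adding it to qubit `j` leaves y_i there,
  -- which is the slot for `c i`.
  refine ⟨cnot i j ∘ fan j A, fun l => if l ∈ A then -(2 ^ l.val / 2 ^ (j.val + 1)) else
    if l = j then c i.val else 0, (isCNOTMap_fan j A hjA).cnot_comp hij, fun q => ?_, ?_⟩
  · dsimp only
    split_ifs with h1 h2
    · simp only [hA, Finset.mem_filter, Finset.mem_univ, true_and] at h1
      exact (IsPhaseAngle.two_pow_div (by omega)).neg
    · exact hc _ (by omega) (by omega)
    · exact IsPhaseAngle.zero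
  · ext y
    have hfj : (cnot i j ∘ fan j A) y j = y i := by
      have h2 : ∀ u v : Fin 2, u + (v + u) = v := by decide
      simp [cnot, fan, hjA, hiA, h2]
    have hfl : ∀ l ∈ A, (cnot i j ∘ fan j A) y l = y l + y j := fun l hl => by
      have : l ≠ j := fun h => hjA (h ▸ hl)
      simp [cnot, fan, this, hl]
    rw [stagePhase, Finset.sum_add_distrib]
    have h1 : (∑ l : Fin (m + 1), if 1 ≤ l.val ∧ l.val + 1 = j.val then
        c l.val * ((y l).val : ℝ) else 0) = c i.val * ((y i).val : ℝ) := by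
      rw [Finset.sum_eq_single i]
      · exact if_pos (by omega)
      · exact fun b _ hb => if_neg fun h => hb (Fin.ext (by omega))
      · simp
    have h2 : (∑ l : Fin (m + 1), if l = j then c i.val * ((y i).val : ℝ) else 0) =
        c i.val * ((y i).val : ℝ) := by simp
    rw [h1, ← h2, ← Finset.sum_add_distrib]
    refine Finset.sum_congr rfl fun l _ => ?_
    have hmem : l ∈ A ↔ 1 ≤ l.val ∧ l.val < j.val := by simp [hA]
    dsimp only
    by_cases hl : l ∈ A
    · have : l ≠ j := fun h => hjA (h ▸ hl)
      rw [if_pos (hmem.1 hl), if_neg this, if_pos hl, hfl l hl, add_zero]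
    · rw [if_neg (fun h => hl (hmem.2 h)), if_neg hl]
      by_cases hlj : l = j
      · subst hlj; rw [if_pos rfl, if_pos rfl, hfj, zero_add]
      · rw [if_neg hlj, if_neg hlj]; simp

theorem realizable_neg_phase_of_cnotMap {f : Basis (m + 1) → Basis (m + 1)} (hf : IsCNOTMap f)
    {a : Fin (m + 1) → ℝ} (ha : ∀ q, IsPhaseAngle (a q)) :
    Realizable 1 (phase (-fun y => ∑ q, a q * ((f y q).val : ℝ))) := by
  convert hf.realizable_phase (fun q => (ha q).neg) using 2
  ext y
  simp

/-- Each stage from the second on costs one cycle on either side. -/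
theorem realizable_conj (c : ℕ → ℝ) (hc : ∀ l, 1 ≤ l → l < m → IsPhaseAngle (c l))
    (p : Basis (m + 1) → ℝ) {d : ℕ} (hp : Realizable d (phase p)) (j : ℕ) (hjm : j + 1 ≤ m) :
    Realizable (d + 2 * j) (conj c p (j + 1)) := by
  induction j with
  | zero =>
    have hv : (Fin.ofNat (m + 1) (0 + 1)).val = 1 := by
      simp only [Fin.ofNat]; exact Nat.mod_eq_of_lt (by omega)
    rw [conj, stagePhase_one c _ hv, neg_zero, phase_zero, Matrix.mul_one, Matrix.one_mul]
    exact (((realizable_had _).mul hp).mul (realizable_had _)).mono (by omega)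
  | succ j ih =>
    have hv : (Fin.ofNat (m + 1) (j + 1 + 1)).val = j + 2 := by
      simp only [Fin.ofNat]; exact Nat.mod_eq_of_lt (by omega)
    obtain ⟨f, a, hf, ha, h⟩ := exists_stagePhase_eq c hc (Fin.ofNat (m + 1) (j + 1 + 1))
      (by omega)
    rw [conj, h]
    exact ((((realizable_had _).mul (realizable_neg_phase_of_cnotMap hf ha)).mul
      (ih (by omega))).mul ((hf.realizable_phase ha).mul (realizable_had _))).mono (by omega)

/-- The diagonal operator in the middle takes two cycles. -/
theorem realizable_phase_midPhase (k : ℕ) {δ : ℝ} (hδ : IsPhaseAngle δ) (s : ℝ)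
    (hs : s = 1 ∨ s = -1) :
    Realizable 2 (phase fun y : Basis (m + 1) => s * midPhase k y + δ * ((y 0).val : ℝ)) := by
  set A : Finset (Fin (m + 1)) := Finset.univ.filter fun l => 1 ≤ l.val ∧ l.val < k + 1 with hA
  have hmem : ∀ l, l ∈ A ↔ 1 ≤ l.val ∧ l.val < k + 1 := fun l => by simp [hA]
  have h0A : (0 : Fin (m + 1)) ∉ A := by simp [hA]
  have hang : ∀ l ∈ A, ∀ t : ℝ, t = 1 ∨ t = -1 → IsPhaseAngle (t * (1 / 2 ^ l.val)) := by
    intro l hl t ht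
    have : IsPhaseAngle (1 / 2 ^ l.val) := by
      simpa using IsPhaseAngle.two_pow_div (l := 0) (j := l.val) ((hmem l).1 hl).1
    rcases ht with rfl | rfl
    · simpa using this
    · simpa using this.neg
  have hpar := (isCNOTMap_fan 0 A h0A).realizable_phase
    (a := fun l => if l ∈ A then -s * (1 / 2 ^ l.val) else 0) (fun l => by
      split_ifs with hl
      · exact hang l hl _ (by rcases hs with rfl | rfl <;> simp)
      · exact IsPhaseAngle.zero)
  -- Qubit 0 is idle in this cycle and takes the extra phase `δ`.
  have hone := realizable_phase_cycle
    (a := fun l : Fin (m + 1) => if l ∈ A then s * (1 / 2 ^ l.val) else if l = 0 then δ else 0)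
    (fun l => by
      split_ifs with hl
      · exact hang l hl _ hs
      · exact hδ
      · exact IsPhaseAngle.zero)
  convert hpar.mul hone using 1
  rw [phase_mul]
  congr 1
  ext y
  have h2 : (∑ l : Fin (m + 1), if l = 0 then δ * ((y 0).val : ℝ) else 0) =
      δ * ((y 0).val : ℝ) := by simp
  simp only [Pi.add_apply, midPhase]
  rw [← h2, Finset.mul_sum, ← Finset.sum_add_distrib, ← Finset.sum_add_distrib]
  refine Finset.sum_congr rfl fun l _ => ?_
  by_cases hl : l ∈ A
  · have hl0 : l ≠ 0 := fun h => h0A (h ▸ hl)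
    rw [if_pos ((hmem l).1 hl), if_neg hl0, if_pos hl, if_pos hl]
    simp only [fan, if_pos hl]
    ring
  · rw [if_neg (fun h => hl ((hmem l).2 h)), if_neg hl, if_neg hl]
    by_cases hl0 : l = 0
    · subst hl0; simp
    · simp [hl0]

/-- The multi-controlled Toffoli gate in linearly many cycles. -/
theorem realizable_mct (hm : 2 ≤ m) : Realizable (4 * m - 2) (mct (Fin.last m)) := by
  rw [mct_eq_conj_mul_conj (by omega)]
  have h1 := realizable_conj (m := m) 0 (fun _ _ _ => IsPhaseAngle.zero) (-midPhase (m - 1)) (d := 2)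
    (by
      convert realizable_phase_midPhase (m := m) (m - 1) IsPhaseAngle.zero (-1) (Or.inr rfl) using 2
      ext y; simp) (m - 2) (by omega)
  have h2 := realizable_conj (m := m) (fun l => 2 ^ l / 2 ^ (m + 1))
    (fun l _ hl => IsPhaseAngle.two_pow_div (by omega))
    (midPhase m + fun y : Basis (m + 1) => 1 / 2 ^ m * ((y 0).val : ℝ)) (d := 2)
    (by
      convert realizable_phase_midPhase (m := m) m (δ := 1 / 2 ^ m)
        (by simpa using IsPhaseAngle.two_pow_div (l := 0) (j := m) (by omega)) 1 (Or.inl rfl) using 2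
      ext y; simp) (m - 1) (by omega)
  rw [show m - 2 + 1 = m - 1 by omega] at h1
  rw [show m - 1 + 1 = m by omega] at h2
  exact (h1.mul h2).mono (by omega)

/-! ### Parity expansions for four and five qubits -/

/-- The multi-controlled Toffoli gate is the multi-controlled `Z` gate between two Hadamard
gates on the target. -/
theorem mct_eq_had_phase_had (t : Fin n) :
    mct t = had t * (phase (fun y => ((∏ j, y j).val : ℝ)) * had t) := by
  have h : phase (fun y : Basis n => ((∏ j, y j).val : ℝ)) * had t = had t * mct t := by
    refine op_ext fun y => ?_
    have hw : ∀ b, ∏ j, Function.update y t b j = b * ∏ j ∈ Finset.univ.erase t, y j := by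
      intro b
      rw [← Finset.mul_prod_erase _ _ (Finset.mem_univ t), Function.update_self]
      congr 1
      exact Finset.prod_congr rfl fun j hj =>
        Function.update_of_ne (Finset.ne_of_mem_erase hj) _ _
    simp only [mct, ← Matrix.mulVec_mulVec, ofBasisMap_mulVec_ket, had, onQubit_mulVec_ket,
      Matrix.mulVec_sum, Matrix.mulVec_smul, phase_mulVec_ket, smul_smul, Function.update_self,
      Function.update_idem, hw]
    refine Finset.sum_congr rfl fun b _ => ?_
    congr 1
    rw [hadamard_apply, hadamard_apply]
    have hb : b = 0 ∨ b = 1 := by fin_cases b <;> simp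
    rcases hb with rfl | rfl
    · simp
    · simp only [Fin.val_one, Nat.cast_one, one_mul]
      rw [exp_val_add]
      ring
  rw [h, ← Matrix.mul_assoc, had_mul_had, Matrix.one_mul]

/-- The basis map of a list of CNOT gates. -/
def cnots (L : List (Fin n × Fin n)) (y : Basis n) : Basis n :=
  L.foldl (fun z p => cnot p.1 p.2 z) y

theorem isCNOTMap_cnots (L : List (Fin n × Fin n)) (hL : ∀ p ∈ L, p.1 ≠ p.2) :
    IsCNOTMap (cnots L) := by
  induction L using List.reverseRecOn with
  | nil => exact isCNOTMap_id
  | append_singleton L p ih =>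
    have h : cnots (L ++ [p]) = cnot p.1 p.2 ∘ cnots L := by
      funext y
      simp [cnots]
    rw [h]
    exact (ih fun p hp => hL p (by simp [hp])).cnot_comp (hL p (by simp))

/-- The sum, over a list of cycles, of the bits computed by CNOT gates with their coefficients. -/
def parityPoly (P : List (List (Fin n × Fin n) × (Fin n → ℤ))) (y : Basis n) : ℤ :=
  (P.map fun p => ∑ q, p.2 q * ((cnots p.1 y q).val : ℤ)).sum

theorem realizable_parityPoly (k : ℕ) (hk : 1 ≤ k)
    (P : List (List (Fin n × Fin n) × (Fin n → ℤ)))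
    (hP : ∀ p ∈ P, (∀ e ∈ p.1, e.1 ≠ e.2) ∧ ∀ q, p.2 q = 0 ∨ p.2 q = 1 ∨ p.2 q = -1) :
    Realizable P.length (phase fun y : Basis n => (parityPoly P y : ℝ) / 2 ^ k) := by
  induction P with
  | nil =>
    rw [List.length_nil]
    convert realizable_one using 1
    rw [← phase_zero]
    congr 1
    ext y
    simp [parityPoly]
  | cons p P ih =>
    have h1 := hP p (by simp)
    have h2 := (isCNOTMap_cnots p.1 h1.1).realizable_phase (a := fun q => (p.2 q : ℝ) / 2 ^ k)
      (fun q => by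
        rcases h1.2 q with h | h | h <;> rw [h]
        · simp [IsPhaseAngle]
        · exact Or.inr ⟨k, hk, Or.inl (by simp)⟩
        · exact Or.inr ⟨k, hk, Or.inr (by simp [neg_div])⟩)
    rw [List.length_cons]
    convert (ih fun p hp => hP p (by simp [hp])).mul h2 using 1
    rw [phase_mul]
    congr 1
    ext y
    simp only [parityPoly, List.map_cons, List.sum_cons, Int.cast_add, Int.cast_sum, Int.cast_mul,
      Int.cast_natCast, Pi.add_apply, add_div, Finset.sum_div]
    rw [add_comm]
    congr 1
    exact Finset.sum_congr rfl fun q _ => by ring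

/-- Meant for k = n - 1: the product of the bits times 2^(n-1) is the sum of (-1)^(|S|+1) times the
parity over S, for all nonempty S. Each parity then needs one phase gate of angle ±π / 2^k. -/
theorem realizable_mct_of_parityPoly (t : Fin n) (k : ℕ) (hk : 1 ≤ k)
    (P : List (List (Fin n × Fin n) × (Fin n → ℤ)))
    (hP : ∀ p ∈ P, (∀ e ∈ p.1, e.1 ≠ e.2) ∧ ∀ q, p.2 q = 0 ∨ p.2 q = 1 ∨ p.2 q = -1)
    (h : ∀ y : Basis n, parityPoly P y = 2 ^ k * ((∏ j, y j).val : ℤ)) :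
    Realizable P.length (mct t) := by
  have h1 := realizable_parityPoly k hk P hP
  simp only [h] at h1
  rw [mct_eq_had_phase_had]
  have h2 : (fun y : Basis n => ((2 ^ k * ((∏ j, y j).val : ℤ) : ℤ) : ℝ) / 2 ^ k) =
      fun y => ((∏ j, y j).val : ℝ) := by
    ext y
    push_cast
    field_simp
  rw [h2] at h1
  exact ((realizable_had t).mul (h1.mul (realizable_had t))).mono (by omega)

/-- Four cycles that compute all parities of four bits. -/
def parityCycles₄ : List (List (Fin 4 × Fin 4) × (Fin 4 → ℤ)) :=
  [([], ![1, 1, 1, 1]),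
    ([(3, 2), (0, 3), (2, 0), (0, 1)], ![1, -1, -1, -1]),
    ([(1, 0), (3, 1), (0, 2), (0, 3)], ![-1, -1, 1, 1]),
    ([(2, 1), (1, 3), (2, 0)], ![-1, -1, 0, 1])]

/-- Seven cycles that compute all parities of five bits. -/
def parityCycles₅ : List (List (Fin 5 × Fin 5) × (Fin 5 → ℤ)) :=
  [([], ![1, 1, 1, 1, 1]),
    ([(1, 4), (0, 3), (2, 1), (0, 2), (1, 0)], ![1, -1, -1, -1, -1]),
    ([(3, 2), (3, 1), (4, 3), (2, 4), (2, 0)], ![1, -1, -1, -1, 1]),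
    ([(1, 0), (4, 1), (0, 1), (0, 4), (0, 3), (3, 2)], ![-1, -1, -1, 1, 1]),
    ([(2, 4), (3, 1), (1, 2), (4, 0), (0, 3)], ![1, 0, 1, -1, -1]),
    ([(1, 3), (3, 2), (4, 3), (3, 0), (0, 1), (2, 4)], ![-1, 1, 0, 1, -1]),
    ([(4, 1), (2, 0), (1, 2), (2, 4), (0, 4), (0, 1), (1, 3), (1, 0)], ![0, -1, 1, 1, 0])]

/-- The 15 parities fit into 4 · 4 slots, one of them idle. -/
theorem realizable_mct_four (t : Fin 4) : Realizable 4 (mct t) :=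
  realizable_mct_of_parityPoly t 3 (by norm_num) parityCycles₄ (by decide +kernel)
    (by decide +kernel)

/-- The 31 parities fit into 7 · 5 slots, four of them idle. -/
theorem realizable_mct_five (t : Fin 5) : Realizable 7 (mct t) :=
  realizable_mct_of_parityPoly t 4 (by norm_num) parityCycles₅ (by decide +kernel)
    (by decide +kernel)

/-! ### Circuits of the exact depth -/

/-- The phase depth of the circuits for the multi-controlled Toffoli gate on `n` qubits. -/
def mctDepth (n : ℕ) : ℕ := if n = 4 then 7 else if n = 5 then 13 else 4 * n - 6

theorem exists_circuit_mct (n : ℕ) (hn : 4 ≤ n) (t : Fin n) (ht : t.val + 1 = n) :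
    ∃ C : Circuit n, C.toOp = mct t ∧ C.phaseDepth = mctDepth n := by
  have hR : Realizable (mctDepth n) (mct t) := by
    by_cases h4 : n = 4
    · subst h4
      exact (realizable_mct_four _).mono (by simp [mctDepth])
    by_cases h5 : n = 5
    · subst h5
      exact (realizable_mct_five _).mono (by simp [mctDepth])
    obtain ⟨m, rfl⟩ : ∃ m, n = m + 1 := ⟨n - 1, by omega⟩
    obtain rfl : t = Fin.last m := Fin.ext (by simpa using ht)
    refine (realizable_mct (m := m) (by omega)).mono ?_
    rw [mctDepth, if_neg h4, if_neg h5]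
    omega
  obtain ⟨C, hC, hd⟩ := hR
  obtain ⟨C', h1, h2⟩ := hd.exists_phaseDepth_eq le_rfl (by unfold mctDepth; split_ifs <;> omega)
    t
  exact ⟨C', h1.trans hC, h2⟩

end CliffordZN

end

theorem theorem3 :
    ∃ C : (n : ℕ) → CliffordZN.Circuit n,
      (∀ (n : ℕ) (hn : 4 ≤ n),
        (C n).toOp = CliffordZN.mct (⟨n - 1, by omega⟩ : Fin n) ∧
        (n = 4 → (C n).phaseDepth = 7) ∧
        (n = 5 → (C n).phaseDepth = 13) ∧
        (6 ≤ n → (C n).phaseDepth = 4 * n - 6)) ∧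
      (fun n : ℕ => ((C n).phaseDepth : ℝ)) =O[Filter.atTop] (fun n : ℕ => (n : ℝ)) := by
  classical
  choose C h1 h2 using fun (n : ℕ) (hn : 4 ≤ n) => CliffordZN.exists_circuit_mct n hn
    ⟨n - 1, by omega⟩ (Nat.sub_add_cancel (by omega))
  have hC : ∀ (n : ℕ) (hn : 4 ≤ n), (if h : 4 ≤ n then C n h else []) = C n hn :=
    fun n hn => dif_pos hn
  -- Nothing is required below `n = 4`; the empty circuit is a default value.
  refine ⟨fun n => if h : 4 ≤ n then C n h else [], fun n hn => ?_, ?_⟩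
  · simp only [hC n hn]
    refine ⟨h1 n hn, ?_, ?_, ?_⟩ <;> intro h <;> rw [h2 n hn, CliffordZN.mctDepth]
    · rw [if_pos h]
    · rw [if_neg (by omega), if_pos h]
    · rw [if_neg (by omega), if_neg (by omega)]
  · refine Asymptotics.IsBigO.of_bound 4 ?_
    filter_upwards [Filter.eventually_ge_atTop 6] with n hn
    rw [hC n (by omega), h2, CliffordZN.mctDepth, if_neg (by omega), if_neg (by omega),
      Real.norm_natCast, Real.norm_natCast]
    exact_mod_cast Nat.sub_le _ _
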